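/- A \emph{Heyting algebra} is considered in the language $\wedge,\vee,\to,\neg$. A \emph{variety} of Heyting algebras is the class of all Heyting algebras satisfying some set of identities $s\approx t$; it \emph{omits} an algebra $B$ if no member of it is isomorphic to $B$, and it is \emph{locally finite} if every finitely generated algebra in it is finite. A \emph{superintuitionistic logic} (si-logic) is a set $L$ of propositional formulas (in $\wedge,\vee,\to,\neg$ over countably many variables) that contains all theorems of intuitionistic propositional logic and is closed under modus ponens and simultaneous substitution. A Heyting algebra $A$ is a \emph{model} of $L$ if every formula of $L$ takes the value $1$ in $A$ under every valuation. The logic $L$ is \emph{locally tabular} if for each finite set $X$ of variables there are only finitely many formulas with variables in $X$ up to the equivalence relation "$p\to q\in L$ and $q\to p\in L$". Let $P_2=\mathbf 2+Z_7$ be the eight-element Heyting algebra with elements $0,z,a,b,c,d,e,1$ and covering relations $0<z$, $z<a$, $z<b$, $a<c$, $b<c$, $b<d$, $c<e$, $d<e$, $e<1$. (Here the elements other than $0$ form the seven-element one-generated Heyting algebra $Z_7$, generated by $b$, and $0$ is a new least element added below it.) \textbf{Theorem.} (i) Every variety of Heyting algebras that omits $P_2$ is locally finite. (ii) Every si-logic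 of which $P_2$ is not a model is locally tabular. -/

import Mathlib

universe u

/-- Propositional formulas over countably many variables, with the connectives `∧, ∨, →, ¬`.
They also serve as the terms of the language of Heyting algebras. -/
inductive PropFormula : Type
  | var : ℕ → PropFormula
  | and : PropFormula → PropFormula → PropFormula
  | or : PropFormula → PropFormula → PropFormula
  | imp : PropFormula → PropFormula → PropFormula
  | neg : PropFormula → PropFormula

namespace PropFormula

/-- The value of a formula in a Heyting algebra under a valuation of the variables. -/
def eval {A : Type u} [HeytingAlgebra A] (v : ℕ → A) : PropFormula → A
  | var i => v i
  | and p q => eval v p ⊓ eval v q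
  | or p q => eval v p ⊔ eval v q
  | imp p q => eval v p ⇨ eval v q
  | neg p => (eval v p)ᶜ

/-- Simultaneous substitution of formulas for variables. -/
def subst (s : ℕ → PropFormula) : PropFormula → PropFormula
  | var i => s i
  | and p q => and (subst s p) (subst s q)
  | or p q => or (subst s p) (subst s q)
  | imp p q => imp (subst s p) (subst s q)
  | neg p => neg (subst s p)

/-- The set of variables occurring in a formula. -/
def vars : PropFormula → Set ℕ
  | var i => {i}
  | and p q => vars p ∪ vars q
  | or p q => vars p ∪ vars q
  | imp p q => vars p ∪ vars q
  | neg p => vars p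

/-- Theorems of intuitionistic propositional logic, in a standard Hilbert-style axiomatization
whose only rule is modus ponens. -/
inductive IntTheorem : PropFormula → Prop
  | k (p q : PropFormula) : IntTheorem (imp p (imp q p))
  | s (p q r : PropFormula) :
      IntTheorem (imp (imp p q) (imp (imp p (imp q r)) (imp p r)))
  | and_intro (p q : PropFormula) : IntTheorem (imp p (imp q (and p q)))
  | and_left (p q : PropFormula) : IntTheorem (imp (and p q) p)
  | and_right (p q : PropFormula) : IntTheorem (imp (and p q) q)
  | or_left (p q : PropFormula) : IntTheorem (imp p (or p q))
  | or_right (p q : PropFormula) : IntTheorem (imp q (or p q))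
  | or_elim (p q r : PropFormula) :
      IntTheorem (imp (imp p r) (imp (imp q r) (imp (or p q) r)))
  | neg_intro (p q : PropFormula) :
      IntTheorem (imp (imp p q) (imp (imp p (neg q)) (neg p)))
  | neg_elim (p q : PropFormula) : IntTheorem (imp (neg p) (imp p q))
  | mp (p q : PropFormula) : IntTheorem (imp p q) → IntTheorem p → IntTheorem q

end PropFormula

/-- A superintuitionistic logic: a set of formulas that contains all theorems of intuitionistic
propositional logic and is closed under modus ponens and simultaneous substitution. -/
structure IsSILogic (L : Set PropFormula) : Prop where
  int_subset : ∀ p : PropFormula, PropFormula.IntTheorem p → p ∈ L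
  modus_ponens : ∀ p q : PropFormula, PropFormula.imp p q ∈ L → p ∈ L → q ∈ L
  substitution : ∀ (s : ℕ → PropFormula) (p : PropFormula), p ∈ L → p.subst s ∈ L

/-- The Heyting algebra `A` is a model of `L`: all formulas of `L` are valid in `A`. -/
def IsModelOf (A : Type u) [HeytingAlgebra A] (L : Set PropFormula) : Prop :=
  ∀ p ∈ L, ∀ v : ℕ → A, p.eval v = ⊤

/-- A logic is locally tabular if over each finite set of variables there are, up to provable
equivalence in the logic, only finitely many formulas. -/
def IsLocallyTabular (L : Set PropFormula) : Prop :=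
  ∀ X : Set ℕ, X.Finite → ∃ F : Set PropFormula, F.Finite ∧
    ∀ p : PropFormula, p.vars ⊆ X →
      ∃ q ∈ F, PropFormula.imp p q ∈ L ∧ PropFormula.imp q p ∈ L

/-- A class of Heyting algebras is a variety if it is the class of all Heyting algebras that
satisfy some set `E` of identities `s ≈ t`. -/
def IsHeytingVariety (K : ∀ (A : Type u) [HeytingAlgebra A], Prop) : Prop :=
  ∃ E : Set (PropFormula × PropFormula), ∀ (A : Type u) [HeytingAlgebra A],
    K A ↔ ∀ e ∈ E, ∀ v : ℕ → A, e.1.eval v = e.2.eval v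

/-- A class of Heyting algebras omits `B` if none of its members is isomorphic to `B`. -/
def OmitsAlgebra (K : ∀ (A : Type u) [HeytingAlgebra A], Prop)
    (B : Type) [HeytingAlgebra B] : Prop :=
  ∀ (A : Type u) [HeytingAlgebra A], K A → IsEmpty (A ≃o B)

/-- `S` is (the universe of) a subalgebra of the Heyting algebra `A`. -/
structure IsHeytingSubalgebra {A : Type u} [HeytingAlgebra A] (S : Set A) : Prop where
  bot_mem : ⊥ ∈ S
  top_mem : ⊤ ∈ S
  inf_mem : ∀ a ∈ S, ∀ b ∈ S, a ⊓ b ∈ S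
  sup_mem : ∀ a ∈ S, ∀ b ∈ S, a ⊔ b ∈ S
  himp_mem : ∀ a ∈ S, ∀ b ∈ S, a ⇨ b ∈ S
  compl_mem : ∀ a ∈ S, aᶜ ∈ S

/-- `A` is finitely generated: some finite subset lies in no proper subalgebra. -/
def IsFinitelyGeneratedHeyting (A : Type u) [HeytingAlgebra A] : Prop :=
  ∃ G : Set A, G.Finite ∧ ∀ S : Set A, IsHeytingSubalgebra S → G ⊆ S → S = Set.univ

/-- A class of Heyting algebras is locally finite if its finitely generated members are finite. -/
def IsLocallyFiniteClass (K : ∀ (A : Type u) [HeytingAlgebra A], Prop) : Prop :=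
  ∀ (A : Type u) [HeytingAlgebra A], K A → IsFinitelyGeneratedHeyting A → Finite A

/-- The eight elements of the algebra `P2 = 2 + Z7`.  The covering relations are
`zero < z`, `z < a`, `z < b`, `a < c`, `b < c`, `b < d`, `c < e`, `d < e`, `e < one`;
the elements from `z` to `one` form the seven-element one-generated algebra `Z7`, with
generator `b`. -/
inductive P2 : Type
  | zero | z | a | b | c | d | e | one
  deriving DecidableEq

namespace P2

instance : Fintype P2 where
  elems := {zero, z, a, b, c, d, e, one}
  complete x := by cases x <;> decide

/-- The order of `P2`. -/
def leb : P2 → P2 → Bool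
  | zero, _ => true
  | z, zero => false
  | z, _ => true
  | a, a | a, c | a, e | a, one => true
  | b, b | b, c | b, d | b, e | b, one => true
  | c, c | c, e | c, one => true
  | d, d | d, e | d, one => true
  | e, e | e, one => true
  | one, one => true
  | _, _ => false

/-- Joins in `P2`; the incomparable pairs are `{a, b}`, `{a, d}` and `{c, d}`. -/
def join (x y : P2) : P2 :=
  if leb x y then y else if leb y x then x else
  match x, y with
  | a, b | b, a => c
  | _, _ => e

/-- Meets in `P2`. -/
def meet (x y : P2) : P2 :=
  if leb x y then x else if leb y x then y else
  match x, y with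
  | c, d | d, c => b
  | _, _ => z

/-- Relative pseudocomplements in `P2`. -/
def arrow (x y : P2) : P2 :=
  if leb x y then one else
  match x, y with
  | a, z => d
  | b, z => a
  | d, z => a
  | a, b => d
  | c, b => d
  | d, b => c
  | _, y => y

instance : HeytingAlgebra P2 where
  le x y := leb x y = true
  le_refl := by decide
  le_trans := by decide
  le_antisymm := by decide
  sup := join
  le_sup_left := by decide
  le_sup_right := by decide
  sup_le := by decide
  inf := meet
  inf_le_left := by decide
  inf_le_right := by decide
  le_inf := by decide
  top := one
  le_top := by decide
  bot := zero
  bot_le := by decide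
  himp := arrow
  le_himp_iff := by decide
  compl x := arrow x zero
  himp_bot := by decide

end P2

/-! On the elements above `z`, the map `x ↦ x ⇨ z` is a pseudocomplementation; write `¬` for it. If
`¬b ∨ ¬¬b ∨ (¬¬b → b)` differs from `⊤` for some dense `z ≤ b`, then a quotient of the algebra
contains a copy of `P2` (`P2.valid_of_not_relRegularity`). Hence excluding `P2` forces
`RelRegularity z b` for all dense `z ≤ b`, in the given algebra for (i) and in the Lindenbaum
algebra for (ii). It remains to show that finitely generated subalgebras are then finite.

Let `G` be a finite set above `z` and `w = decided z G`. Below `w` the generators cut out Boolean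
cells, so `a ⊓ w` takes finitely many values on generated `a`, and `a` is recovered from `a ⊓ w` and
`a ⊔ w`. In a well-connected algebra, relative regularity makes `a ⊔ w` generated by `w` and the `g
⊔ w` (`Gen.sup_decided`). At most two such passages lose a generator or show that there is none, so
induction bounds the size by a function of `G.card` alone (`exists_bound_wellConnected`).

Well-connected quotients separate points, and the uniform bound leaves only finitely many behaviours
on the generated elements (`Gen.finite_of_separating`). Since relative regularity is available only
over dense elements, one preliminary passage from `⊥` to the dense element `decided ⊥ G` is needed
(`Gen.finite_of_relRegularity_dense`). -/

/-! ### Quotients of preordered Heyting structures -/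

/-- A type with operations that satisfy the laws of Heyting algebras up to a preorder. -/
structure PreHeyting (α : Type u) where
  le : α → α → Prop
  inf : α → α → α
  sup : α → α → α
  himp : α → α → α
  bot : α
  le_refl : ∀ a, le a a
  le_trans : ∀ a b c, le a b → le b c → le a c
  inf_le_left : ∀ a b, le (inf a b) a
  inf_le_right : ∀ a b, le (inf a b) b
  le_inf : ∀ a b c, le a b → le a c → le a (inf b c)
  le_sup_left : ∀ a b, le a (sup a b)
  le_sup_right : ∀ a b, le b (sup a b)
  sup_le : ∀ a b c, le a c → le b c → le (sup a b) c
  le_himp_iff : ∀ a b c, le a (himp b c) ↔ le (inf a b) c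
  bot_le : ∀ a, le bot a

namespace PreHeyting

variable {α : Type u} (H : PreHeyting α)

/-- The equivalence relation of a pre-Heyting structure. -/
def setoid : Setoid α where
  r a b := H.le a b ∧ H.le b a
  iseqv :=
    { refl := fun a => ⟨H.le_refl a, H.le_refl a⟩
      symm := fun h => ⟨h.2, h.1⟩
      trans := fun h k => ⟨H.le_trans _ _ _ h.1 k.1, H.le_trans _ _ _ k.2 h.2⟩ }

/-- The Heyting algebra of equivalence classes of a pre-Heyting structure. -/
def Quo : Type u := Quotient H.setoid

/-- The class of an element. -/
def cls (a : α) : H.Quo := Quotient.mk H.setoid a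

theorem cls_surjective (x : H.Quo) : ∃ a, H.cls a = x := Quotient.exists_rep x

theorem inf_mono {a a' b b' : α} (h : H.le a a') (k : H.le b b') :
    H.le (H.inf a b) (H.inf a' b') :=
  H.le_inf _ _ _ (H.le_trans _ _ _ (H.inf_le_left _ _) h)
    (H.le_trans _ _ _ (H.inf_le_right _ _) k)

theorem sup_mono {a a' b b' : α} (h : H.le a a') (k : H.le b b') :
    H.le (H.sup a b) (H.sup a' b') :=
  H.sup_le _ _ _ (H.le_trans _ _ _ h (H.le_sup_left _ _))
    (H.le_trans _ _ _ k (H.le_sup_right _ _))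

theorem himp_mono {a a' b b' : α} (h : H.le a' a) (k : H.le b b') :
    H.le (H.himp a b) (H.himp a' b') := by
  rw [H.le_himp_iff]
  refine H.le_trans _ _ _ (H.inf_mono (H.le_refl _) h) ?_
  exact H.le_trans _ _ _ ((H.le_himp_iff _ _ _).1 (H.le_refl _)) k

instance : PartialOrder H.Quo where
  le := Quotient.lift₂ (s₁ := H.setoid) (s₂ := H.setoid) H.le
    fun _ _ _ _ (h : H.le _ _ ∧ H.le _ _) (k : H.le _ _ ∧ H.le _ _) => propext
    ⟨fun l => H.le_trans _ _ _ h.2 (H.le_trans _ _ _ l k.1),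
      fun l => H.le_trans _ _ _ h.1 (H.le_trans _ _ _ l k.2)⟩
  le_refl := by rintro ⟨a⟩; exact H.le_refl a
  le_trans := by rintro ⟨a⟩ ⟨b⟩ ⟨c⟩; exact H.le_trans a b c
  le_antisymm := by rintro ⟨a⟩ ⟨b⟩ h k; exact Quotient.sound ⟨h, k⟩

instance : HeytingAlgebra H.Quo where
  inf := Quotient.map₂ (sa := H.setoid) (sb := H.setoid) (sc := H.setoid) H.inf
    fun _ _ (h : H.le _ _ ∧ H.le _ _) _ _ (k : H.le _ _ ∧ H.le _ _) =>
      ⟨H.inf_mono h.1 k.1, H.inf_mono h.2 k.2⟩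
  sup := Quotient.map₂ (sa := H.setoid) (sb := H.setoid) (sc := H.setoid) H.sup
    fun _ _ (h : H.le _ _ ∧ H.le _ _) _ _ (k : H.le _ _ ∧ H.le _ _) =>
      ⟨H.sup_mono h.1 k.1, H.sup_mono h.2 k.2⟩
  himp := Quotient.map₂ (sa := H.setoid) (sb := H.setoid) (sc := H.setoid) H.himp
    fun _ _ (h : H.le _ _ ∧ H.le _ _) _ _ (k : H.le _ _ ∧ H.le _ _) =>
      ⟨H.himp_mono h.2 k.1, H.himp_mono h.1 k.2⟩
  compl x := Quotient.map₂ (sa := H.setoid) (sb := H.setoid) (sc := H.setoid) H.himp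
    (fun _ _ (h : H.le _ _ ∧ H.le _ _) _ _ (k : H.le _ _ ∧ H.le _ _) =>
      ⟨H.himp_mono h.2 k.1, H.himp_mono h.1 k.2⟩) x (H.cls H.bot)
  bot := H.cls H.bot
  top := H.cls (H.himp H.bot H.bot)
  inf_le_left := by rintro ⟨a⟩ ⟨b⟩; exact H.inf_le_left a b
  inf_le_right := by rintro ⟨a⟩ ⟨b⟩; exact H.inf_le_right a b
  le_inf := by rintro ⟨a⟩ ⟨b⟩ ⟨c⟩; exact H.le_inf a b c
  le_sup_left := by rintro ⟨a⟩ ⟨b⟩; exact H.le_sup_left a b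
  le_sup_right := by rintro ⟨a⟩ ⟨b⟩; exact H.le_sup_right a b
  sup_le := by rintro ⟨a⟩ ⟨b⟩ ⟨c⟩; exact H.sup_le a b c
  le_himp_iff := by rintro ⟨a⟩ ⟨b⟩ ⟨c⟩; exact H.le_himp_iff a b c
  bot_le := by rintro ⟨a⟩; exact H.bot_le a
  le_top := by rintro ⟨a⟩; exact (H.le_himp_iff _ _ _).2 (H.inf_le_right _ _)
  himp_bot := fun _ => rfl

theorem cls_le_cls {a b : α} : H.cls a ≤ H.cls b ↔ H.le a b := Iff.rfl

end PreHeyting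

/-- A map between Heyting algebras that preserves the operations commutes with evaluation. -/
theorem PropFormula.map_eval {A : Type*} {B : Type*} [HeytingAlgebra A] [HeytingAlgebra B]
    (f : A → B) (hbot : f ⊥ = ⊥) (hinf : ∀ a b, f (a ⊓ b) = f a ⊓ f b)
    (hsup : ∀ a b, f (a ⊔ b) = f a ⊔ f b) (himp : ∀ a b, f (a ⇨ b) = f a ⇨ f b)
    (v : ℕ → A) (p : PropFormula) : f (p.eval v) = p.eval (f ∘ v) := by
  induction p with
  | var i => rfl
  | and p q hp hq => simp [eval, hinf, hp, hq]
  | or p q hp hq => simp [eval, hsup, hp, hq]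
  | imp p q hp hq => simp [eval, himp, hp, hq]
  | neg p hp => rw [eval, eval, ← himp_bot, ← himp_bot, himp, hbot, hp]

/-! ### Quotients by filters -/

section FilterQuotient

open Order

variable {A : Type u} [HeytingAlgebra A]

/-- The pre-Heyting structure whose quotient is the quotient of `A` by a filter. -/
def filterPreHeyting (F : PFilter A) : PreHeyting A where
  le a b := a ⇨ b ∈ F
  inf := (· ⊓ ·)
  sup := (· ⊔ ·)
  himp := (· ⇨ ·)
  bot := ⊥
  le_refl a := by rw [himp_eq_top_iff.2 le_rfl]; exact PFilter.top_mem
  le_trans a b c h k := PFilter.mem_of_le (himp_triangle a b c) (PFilter.inf_mem h k)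
  inf_le_left a b := by rw [himp_eq_top_iff.2 inf_le_left]; exact PFilter.top_mem
  inf_le_right a b := by rw [himp_eq_top_iff.2 inf_le_right]; exact PFilter.top_mem
  le_inf a b c h k := by
    rw [himp_inf_distrib]; exact PFilter.inf_mem h k
  le_sup_left a b := by rw [himp_eq_top_iff.2 le_sup_left]; exact PFilter.top_mem
  le_sup_right a b := by rw [himp_eq_top_iff.2 le_sup_right]; exact PFilter.top_mem
  sup_le a b c h k := by
    rw [sup_himp_distrib]; exact PFilter.inf_mem h k
  le_himp_iff a b c := by rw [himp_himp]
  bot_le a := by rw [himp_eq_top_iff.2 bot_le]; exact PFilter.top_mem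

/-- The quotient map by a filter. -/
def filterMk (F : PFilter A) : A → (filterPreHeyting F).Quo := (filterPreHeyting F).cls

variable (F : PFilter A)

theorem filterMk_surjective (x : (filterPreHeyting F).Quo) : ∃ a, filterMk F a = x :=
  (filterPreHeyting F).cls_surjective x

theorem filterMk_le {a b : A} : filterMk F a ≤ filterMk F b ↔ a ⇨ b ∈ F := Iff.rfl
theorem filterMk_inf (a b : A) : filterMk F (a ⊓ b) = filterMk F a ⊓ filterMk F b := rfl
theorem filterMk_sup (a b : A) : filterMk F (a ⊔ b) = filterMk F a ⊔ filterMk F b := rfl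
theorem filterMk_himp (a b : A) : filterMk F (a ⇨ b) = filterMk F a ⇨ filterMk F b := rfl
theorem filterMk_bot : filterMk F (⊥ : A) = ⊥ := rfl
theorem filterMk_top : filterMk F (⊤ : A) = ⊤ := by
  rw [← himp_self (a := (⊥ : A)), filterMk_himp, himp_self]

theorem filterMk_eq_top {a : A} : filterMk F a = ⊤ ↔ a ∈ F := by
  rw [← top_le_iff, ← filterMk_top, filterMk_le, top_himp]

theorem filterQuotient_valid {s t : PropFormula} (h : ∀ v : ℕ → A, s.eval v = t.eval v)
    (v : ℕ → (filterPreHeyting F).Quo) : s.eval v = t.eval v := by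
  choose w hw using fun i => filterMk_surjective F (v i)
  obtain rfl : filterMk F ∘ w = v := funext hw
  rw [← PropFormula.map_eval (filterMk F) rfl (fun _ _ => rfl) (fun _ _ => rfl) (fun _ _ => rfl),
    ← PropFormula.map_eval (filterMk F) rfl (fun _ _ => rfl) (fun _ _ => rfl) (fun _ _ => rfl), h]

end FilterQuotient

/-! ### Copies of `P2` and relative regularity -/

namespace P2

variable {A : Type u} [HeytingAlgebra A]

/-- The map from `P2` to a Heyting algebra given by the images of `z, a, b, d`. -/
def toHeyting (z a b d : A) : P2 → A
  | P2.zero => ⊥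
  | P2.z => z
  | P2.a => a
  | P2.b => b
  | P2.c => a ⊔ b
  | P2.d => d
  | P2.e => a ⊔ d
  | P2.one => ⊤

/-- The relations determine all operation tables, so `toHeyting` is a homomorphism. It is injective
because everything except `one` goes below `a ⊔ d ≠ ⊤`. -/
theorem valid_of_embedding {z a b d : A} (hz : z ⇨ ⊥ = ⊥) (hzb : z ≤ b) (ha : b ⇨ z = a)
    (hd : a ⇨ z = d) (hc : d ⇨ b = a ⊔ b) (he : a ⊔ d ≠ ⊤)
    {s t : PropFormula} (h : ∀ v : ℕ → A, s.eval v = t.eval v) (v : ℕ → P2) :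
    s.eval v = t.eval v := by
  have hbd : b ≤ d := by rw [← hd, ← ha]; exact le_himp_himp
  have hza : z ≤ a := by rw [← ha]; exact le_himp
  have hab : a ⊓ b = z := le_antisymm (by rw [← ha]; exact himp_inf_le) (le_inf hza hzb)
  have had : a ⊓ d = z := le_antisymm (by rw [← hd]; exact inf_himp_le) (le_inf hza (hzb.trans hbd))
  have hda : d ⇨ z = a := le_antisymm (by rw [← ha]; exact himp_le_himp_right hbd)
    (by rw [← hd]; exact le_himp_himp)
  have dense : ∀ x, z ≤ x → x ⇨ ⊥ = ⊥ := fun x hx =>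
    le_bot_iff.1 ((himp_le_himp_right hx).trans hz.le)
  have hba : b ⇨ a = a := by
    rw [← ha, himp_himp, inf_idem]
  have hdb : d ⇨ a = a := by rw [← hda, himp_himp, inf_idem]
  have hadd : a ⇨ d = d := by rw [← hd, himp_himp, inf_idem]
  have habd : a ⇨ b = d := by
    apply le_antisymm
    · rw [← hd, le_himp_iff]
      calc (a ⇨ b) ⊓ a ≤ a ⊓ b := le_inf inf_le_right himp_inf_le
        _ = z := hab
    · rw [← hd]; exact himp_le_himp_left hzb
  have hdc : d ⇨ (a ⊔ b) = a ⊔ b := by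
    rw [← hc, himp_himp, inf_idem]
  have hbd' : (a ⊔ b) ⊓ d = b := by
    rw [inf_sup_right, had, inf_eq_left.2 hbd, sup_eq_right.2 hzb]
  have hzd := hzb.trans hbd
  have hzc : z ≤ a ⊔ b := hza.trans le_sup_left
  have hze : z ≤ a ⊔ d := hza.trans le_sup_left
  have hbe : b ≤ a ⊔ d := hbd.trans le_sup_right
  have hba' : b ⊓ a = z := by rw [inf_comm, hab]
  have hda' : d ⊓ a = z := by rw [inf_comm, had]
  have hdb' : d ⊓ (a ⊔ b) = b := by rw [inf_comm, hbd']
  have hba'' : b ⊔ a = a ⊔ b := sup_comm _ _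
  have hda'' : d ⊔ a = a ⊔ d := sup_comm _ _
  have hcd : a ⊔ b ⊔ d = a ⊔ d := by rw [sup_assoc, sup_eq_right.2 hbd]
  have hdc' : d ⊔ (a ⊔ b) = a ⊔ d := by rw [sup_comm, hcd]
  set f := toHeyting z a b d with hf
  have finf : ∀ x y : P2, f (x ⊓ y) = f x ⊓ f y := by
    intro x y
    change f (meet x y) = f x ⊓ f y
    cases x <;> cases y <;>
      simp [toHeyting, meet, leb, *]
  have fsup : ∀ x y : P2, f (x ⊔ y) = f x ⊔ f y := by
    intro x y
    change f (join x y) = f x ⊔ f y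
    cases x <;> cases y <;>
      simp [toHeyting, join, leb, *]
  have fhimp : ∀ x y : P2, f (x ⇨ y) = f x ⇨ f y := by
    intro x y
    change f (arrow x y) = f x ⇨ f y
    rw [eq_comm]
    cases x <;> cases y <;>
      simp [toHeyting, arrow, leb, sup_himp_distrib, *]
  have ftop : ∀ x : P2, f x = ⊤ → x = ⊤ := by
    intro x hx
    have hle : f x ≤ a ⊔ d ∨ x = P2.one := by cases x <;> simp [toHeyting, *]
    rcases hle with hle | rfl
    · exact absurd (top_le_iff.1 (hx ▸ hle)) he
    · rfl
  have inj : ∀ x y : P2, f x = f y → x = y := by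
    intro x y hxy
    apply le_antisymm <;> rw [← himp_eq_top_iff] <;> apply ftop <;>
      rw [fhimp, himp_eq_top_iff, hxy]
  apply inj
  rw [PropFormula.map_eval f rfl finf fsup fhimp, PropFormula.map_eval f rfl finf fsup fhimp, h]

end P2

/-- The weakening of weak excluded middle `¬b ∨ ¬¬b ∨ (¬¬b → b) = 1` for negation relative
to `z`. -/
def RelRegularity {A : Type u} [HeytingAlgebra A] (z b : A) : Prop :=
  (b ⇨ z) ⊔ ((b ⇨ z) ⇨ z) ⊔ (((b ⇨ z) ⇨ z) ⇨ b) = ⊤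

section

variable {A : Type u} [HeytingAlgebra A]

-- In the quotient by the filter generated by `f`, `hc` becomes the equation `d ⇨ b = a ⊔ b` and
-- `he` keeps `a ⊔ d` off the top; the other relations survive in every quotient.
open Order in
theorem P2.valid_of_filter {z a b d f : A} (hz : z ⇨ ⊥ = ⊥) (hzb : z ≤ b) (ha : b ⇨ z = a)
    (hd : a ⇨ z = d) (hc : f ⊓ (d ⇨ b) ≤ a ⊔ b) (he : ¬ f ≤ a ⊔ d)
    {s t : PropFormula} (h : ∀ v : ℕ → A, s.eval v = t.eval v) (v : ℕ → P2) :
    s.eval v = t.eval v := by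
  set F : PFilter A := PFilter.principal f
  refine P2.valid_of_embedding (z := filterMk F z) (a := filterMk F a) (b := filterMk F b)
    (d := filterMk F d) ?_ ?_ ?_ ?_ ?_ ?_ (filterQuotient_valid F h) v
  · rw [← filterMk_bot, ← filterMk_himp, hz]
  · rw [filterMk_le, himp_eq_top_iff.2 hzb]; exact PFilter.top_mem
  · rw [← filterMk_himp, ha]
  · rw [← filterMk_himp, hd]
  · rw [← filterMk_himp, ← filterMk_sup]
    apply le_antisymm
    · rw [filterMk_le]
      exact PFilter.mem_principal.2 (le_himp_iff.2 hc)
    · have had : a ⊓ d ≤ z := by rw [← hd]; exact inf_himp_le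
      have hab : a ⊔ b ≤ d ⇨ b := sup_le (le_himp_iff.2 (had.trans hzb)) le_himp
      rw [filterMk_le, himp_eq_top_iff.2 hab]
      exact PFilter.top_mem
  · rw [← filterMk_sup, Ne, filterMk_eq_top]
    exact fun hm => he (PFilter.mem_principal.1 hm)

/-- If relative regularity fails over a dense element, then `P2` satisfies all identities of
the algebra. -/
theorem P2.valid_of_not_relRegularity {z b : A} (hz : z ⇨ ⊥ = ⊥) (hzb : z ≤ b)
    (hr : ¬ RelRegularity z b) {s t : PropFormula} (h : ∀ v : ℕ → A, s.eval v = t.eval v)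
    (v : ℕ → P2) : s.eval v = t.eval v := by
  set a := b ⇨ z with ha
  set d := a ⇨ z with hd
  have hr' : a ⊔ d ⊔ (d ⇨ b) ≠ ⊤ := hr
  -- If this element is not below `a ⊔ d`, it generates a suitable filter over the base `z`.
  -- Otherwise the base moves up to `b`.
  by_cases hf : (d ⇨ b) ⇨ (a ⊔ b) ≤ a ⊔ d
  · have hbd : b ≤ d := le_himp_himp
    have hza : z ≤ a := le_himp
    have hab : a ⊓ b ≤ z := himp_inf_le
    -- Relative to `b`, the negation of `a ⊔ b` is `d`, and that of `d` is `d ⇨ b`. No quotient is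
    -- needed: `hf` gives the required inequality and `hr'` keeps `d ⊔ (d ⇨ b)` off the top.
    refine P2.valid_of_filter (z := b) (b := a ⊔ b) (a := d) (d := d ⇨ b) (f := ⊤)
      ?_ le_sup_right ?_ rfl ?_ ?_ h v
    · exact le_bot_iff.1 ((himp_le_himp_right hzb).trans hz.le)
    · rw [sup_himp_self_right]
      apply le_antisymm
      · rw [hd, le_himp_iff]
        exact (le_inf inf_le_right himp_inf_le).trans hab
      · exact himp_le_himp_left hzb
    · rw [top_inf_eq]
      exact hf.trans (sup_le (le_sup_left.trans le_sup_right) le_sup_left)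
    · intro hh
      apply hr'
      rw [sup_assoc]
      exact top_le_iff.1 (hh.trans le_sup_right)
  · exact P2.valid_of_filter hz hzb rfl rfl himp_inf_le hf h v

end

/-! ### Generated elements and the decided region -/

section Gen

variable {A : Type u} [HeytingAlgebra A]

/-- The closure of a set under meets, joins and relative pseudocomplements. -/
inductive Gen (S : Set A) : A → Prop
  | base (a : A) : a ∈ S → Gen S a
  | inf (a b : A) : Gen S a → Gen S b → Gen S (a ⊓ b)
  | sup (a b : A) : Gen S a → Gen S b → Gen S (a ⊔ b)
  | himp (a b : A) : Gen S a → Gen S b → Gen S (a ⇨ b)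

theorem Gen.of_subset {S T : Set A} (h : ∀ s ∈ S, Gen T s) {a : A} (ha : Gen S a) : Gen T a := by
  induction ha with
  | base a ha => exact h a ha
  | inf a b _ _ iha ihb => exact .inf _ _ iha ihb
  | sup a b _ _ iha ihb => exact .sup _ _ iha ihb
  | himp a b _ _ iha ihb => exact .himp _ _ iha ihb

theorem Gen.le {S : Set A} {z : A} (h : ∀ s ∈ S, z ≤ s) {a : A} (ha : Gen S a) : z ≤ a := by
  induction ha with
  | base a ha => exact h a ha
  | inf a b _ _ iha ihb => exact le_inf iha ihb
  | sup a b _ _ iha ihb => exact iha.trans le_sup_left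
  | himp a b _ _ iha ihb => exact ihb.trans le_himp

/-- The meet of the elements `g ∨ (g → z)`: the region where all `g ∈ G` are decided. -/
def decided (z : A) (G : Finset A) : A := G.inf fun g => g ⊔ (g ⇨ z)

theorem le_decided {z : A} {G : Finset A} (hG : ∀ g ∈ G, z ≤ g) : z ≤ decided z G :=
  Finset.le_inf fun g hg => (hG g hg).trans le_sup_left

/-- Each `g ⊔ (g ⇨ z)` is dense relative to `z`, and currying passes this on to finite meets. -/
theorem decided_himp {z : A} {G : Finset A} : decided z G ⇨ z = z := by
  classical
  unfold decided
  induction G using Finset.induction_on with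
  | empty => simp
  | insert g G _ ih =>
    rw [Finset.inf_insert, inf_comm, ← himp_himp]
    have : (g ⊔ (g ⇨ z)) ⇨ z = z := by
      apply le_antisymm _ le_himp
      rw [sup_himp_distrib]
      exact inf_himp_le
    rw [this, ih]

/-- The cells are the meets that choose `g` or `g ⇨ z` for each `g`; distributivity makes them cover
the decided region. -/
theorem exists_cells (z : A) (G : Finset A) : ∃ C : Finset A, C.card ≤ 2 ^ G.card ∧
    C.sup id = decided z G ∧ ∀ m ∈ C, ∀ g ∈ G, m ≤ g ∨ m ⊓ g ≤ z := by
  classical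
  induction G using Finset.induction_on with
  | empty => exact ⟨{⊤}, by simp [decided]⟩
  | insert g G hg ih =>
    obtain ⟨C, hcard, hsup, hC⟩ := ih
    refine ⟨C.image (· ⊓ g) ∪ C.image (· ⊓ (g ⇨ z)), ?_, ?_, ?_⟩
    · rw [Finset.card_insert_of_notMem hg, pow_succ, mul_two]
      exact (Finset.card_union_le _ _).trans
        (add_le_add (Finset.card_image_le.trans hcard) (Finset.card_image_le.trans hcard))
    · have h : ∀ x : A, (C.image (· ⊓ x)).sup id = C.sup id ⊓ x := fun x => by
        rw [Finset.sup_image, Finset.sup_inf_distrib_right]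
        rfl
      rw [Finset.sup_union, h, h, ← inf_sup_left, hsup, decided, decided, Finset.inf_insert,
        inf_comm]
    · intro m hm x hx
      rw [Finset.mem_union, Finset.mem_image, Finset.mem_image] at hm
      rw [Finset.mem_insert] at hx
      rcases hm with ⟨m, hm, rfl⟩ | ⟨m, hm, rfl⟩
      · rcases hx with rfl | hx
        · exact .inl inf_le_right
        · exact (hC m hm x hx).imp inf_le_left.trans fun h =>
            (inf_le_inf_right x inf_le_left).trans h
      · rcases hx with rfl | hx
        · exact .inr ((inf_le_inf_right x inf_le_right).trans himp_inf_le)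
        · exact (hC m hm x hx).imp inf_le_left.trans fun h =>
            (inf_le_inf_right x inf_le_left).trans h

/-- On a cell that decides the generators, the operations act as on truth values, with `z` as
falsity. -/
theorem Gen.le_or_inf_le {z m : A} {G : Set A} (hG : ∀ g ∈ G, z ≤ g)
    (hm : ∀ g ∈ G, m ≤ g ∨ m ⊓ g ≤ z) {a : A} (ha : Gen (insert z G) a) :
    m ≤ a ∨ m ⊓ a ≤ z := by
  induction ha with
  | base a ha =>
    rcases ha with rfl | ha
    · exact .inr inf_le_right
    · exact hm a ha
  | inf a b _ _ iha ihb =>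
    rcases iha with iha | iha
    · rcases ihb with ihb | ihb
      · exact .inl (le_inf iha ihb)
      · exact .inr ((inf_le_inf_left m inf_le_right).trans ihb)
    · exact .inr ((inf_le_inf_left m inf_le_left).trans iha)
  | sup a b _ _ iha ihb =>
    rcases iha with iha | iha
    · exact .inl (iha.trans le_sup_left)
    · rcases ihb with ihb | ihb
      · exact .inl (ihb.trans le_sup_right)
      · exact .inr (by rw [inf_sup_left]; exact sup_le iha ihb)
  | himp a b ha hb iha ihb =>
    have hzb : z ≤ b := Gen.le (by rintro s (rfl | hs); exacts [le_rfl, hG s hs]) hb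
    rcases iha with iha | iha
    · rcases ihb with ihb | ihb
      · exact .inl (ihb.trans le_himp)
      · refine .inr (le_trans (le_inf inf_le_left ?_) ihb)
        exact (inf_le_inf_right _ iha).trans inf_himp_le
    · exact .inl (le_himp_iff.2 (iha.trans hzb))

theorem Gen.decided_le {z : A} {G : Finset A} (hG : ∀ g ∈ G, z ≤ g) {a : A}
    (ha : Gen (insert z (G : Set A)) a) : decided z G ≤ a ⊔ (a ⇨ z) := by
  obtain ⟨C, -, hsup, hC⟩ := exists_cells z G
  rw [← hsup]
  refine Finset.sup_le fun m hm => ?_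
  rcases ha.le_or_inf_le hG (hC m hm) with h | h
  · exact h.trans le_sup_left
  · exact (le_himp_iff.2 h).trans le_sup_right

/-- Below the decided region, a generated element is the join of `z` and the cells under it, so a
subset of the cells describes it. -/
theorem exists_traces {z : A} {G : Finset A} (hG : ∀ g ∈ G, z ≤ g) :
    ∃ M : Finset A, M.card ≤ 2 ^ 2 ^ G.card ∧
      ∀ a, Gen (insert z (G : Set A)) a → a ⊓ decided z G ∈ M := by
  classical
  obtain ⟨C, hcard, hsup, hC⟩ := exists_cells z G
  refine ⟨C.powerset.image fun D => z ⊔ D.sup id, ?_, fun a ha => ?_⟩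
  · refine Finset.card_image_le.trans ?_
    rw [Finset.card_powerset]
    exact Nat.pow_le_pow_right two_pos hcard
  · have hza : z ≤ a := Gen.le (by rintro s (rfl | hs); exacts [le_rfl, hG s hs]) ha
    rw [Finset.mem_image]
    refine ⟨C.filter (· ≤ a), by simp, ?_⟩
    apply le_antisymm
    · refine sup_le (le_inf hza (le_decided hG)) (Finset.sup_le fun m hm => ?_)
      rw [Finset.mem_filter] at hm
      exact le_inf hm.2 (hsup ▸ Finset.le_sup (f := id) hm.1)
    · rw [← hsup, Finset.sup_inf_distrib_left]
      refine Finset.sup_le fun m hm => ?_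
      rcases ha.le_or_inf_le hG (hC m hm) with h | h
      · refine inf_le_right.trans (le_trans ?_ le_sup_right)
        exact Finset.le_sup (f := id) (Finset.mem_filter.2 ⟨hm, h⟩)
      · rw [inf_comm]
        exact le_trans h le_sup_left

/-- If every generated element is determined by its parts below and above the decided region,
counting the latter suffices. -/
theorem Gen.encard_le {z : A} {G : Finset A} (hG : ∀ g ∈ G, z ≤ g) {T : Set A}
    (hT : ∀ a, Gen (insert z (G : Set A)) a → Gen T (a ⊔ decided z G)) :
    {a | Gen (insert z (G : Set A)) a}.encard ≤
      ((2 ^ 2 ^ G.card : ℕ) : ℕ∞) * {a | Gen T a}.encard := by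
  obtain ⟨M, hcard, hM⟩ := exists_traces hG
  calc {a | Gen (insert z (G : Set A)) a}.encard
      ≤ ((M : Set A) ×ˢ {a | Gen T a}).encard :=
        Set.encard_le_encard_of_injOn (f := fun a => (a ⊓ decided z G, a ⊔ decided z G))
          (fun a ha => ⟨hM a ha, hT a ha⟩) fun a _ b _ hab =>
            eq_of_inf_eq_sup_eq (Prod.ext_iff.1 hab).1 (Prod.ext_iff.1 hab).2
    _ = M.card * {a | Gen T a}.encard := by rw [Set.encard_prod, Set.encard_coe_eq_coe_finsetCard]
    _ ≤ _ := by gcongr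

/-! ### Relative regularity in well-connected algebras -/

section WellConnected

variable (hwc : ∀ x y : A, x ⊔ y = ⊤ → x = ⊤ ∨ y = ⊤)
include hwc

theorem RelRegularity.cases {z b : A} (h : RelRegularity z b) :
    b ⇨ z = ⊤ ∨ b ⇨ z = z ∨ (b ⇨ z) ⇨ z ≤ b := by
  rcases hwc _ _ h with h | h
  · rcases hwc _ _ h with h | h
    · exact .inl h
    · exact .inr (.inl (le_antisymm (himp_eq_top_iff.1 h) le_himp))
  · exact .inr (.inr (himp_eq_top_iff.1 h))

/-- A relatively regular element other than `z` and `⊤` lies below every relatively dense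
element. -/
theorem RelRegularity.le_of_dense {z w u : A} (hV : ∀ b, z ≤ b → RelRegularity z b)
    (hzw : z ≤ w) (hw : w ⇨ z = z) (hzu : z ≤ u) (h1 : u ⇨ z ≠ ⊤) (h2 : u ⇨ z ≠ z) :
    u ≤ w := by
  -- Meeting with a relatively dense element does not change the negation. So `u ⊓ w` falls under
  -- the regular case as well, whence `u ≤ ¬¬u ≤ u ⊓ w`.
  have h : (u ⊓ w) ⇨ z = u ⇨ z := by rw [← himp_himp, hw]
  rcases RelRegularity.cases hwc (hV (u ⊓ w) (le_inf hzu hzw)) with h3 | h3 | h3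
  · exact absurd (h ▸ h3) h1
  · exact absurd (h ▸ h3) h2
  · rw [h] at h3
    exact le_himp_himp.trans (h3.trans inf_le_right)

variable {z : A} (hV : ∀ b, z ≤ b → RelRegularity z b) {G : Finset A}
include hV

/-- Joining with `w` commutes with `a ⇨ b` when `a ⊓ w ≤ b`; otherwise `a ⇨ b` is absorbed by `w`.
-/
theorem Gen.sup_decided [DecidableEq A] (hG : ∀ g ∈ G, z ≤ g) {a : A}
    (ha : Gen (insert z (G : Set A)) a) :
    Gen (insert (decided z G) (((G.image (· ⊔ decided z G)).erase (decided z G) : Finset A) : Set A))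
      (a ⊔ decided z G) := by
  set w := decided z G with hw
  have hzw : z ≤ w := le_decided hG
  have hwz : w ⇨ z = z := decided_himp
  have hGen : ∀ {x}, Gen (insert z (G : Set A)) x → z ≤ x := fun hx =>
    Gen.le (by rintro s (rfl | hs); exacts [le_rfl, hG s hs]) hx
  have hbase : Gen (insert w (((G.image (· ⊔ w)).erase w : Finset A) : Set A)) w :=
    .base _ (Set.mem_insert _ _)
  induction ha with
  | base a ha =>
    rcases ha with rfl | ha
    · rwa [sup_eq_right.2 hzw]
    · by_cases h : a ⊔ w = w
      · rwa [h]
      · refine .base _ (.inr ?_)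
        exact Finset.mem_coe.2 (Finset.mem_erase.2 ⟨h, Finset.mem_image_of_mem _ ha⟩)
  | inf a b _ _ iha ihb => rw [sup_inf_right]; exact .inf _ _ iha ihb
  | sup a b _ _ iha ihb =>
    rw [sup_sup_distrib_right]; exact .sup _ _ iha ihb
  | himp a b ha hb iha ihb =>
    by_cases hab : a ⊓ w ≤ b
    · have : (a ⇨ b) ⊔ w = (a ⊔ w) ⇨ (b ⊔ w) := by
        apply le_antisymm
        · refine sup_le (le_himp_iff.2 ?_) (le_sup_right.trans le_himp)
          rw [inf_sup_left]
          exact sup_le (himp_inf_le.trans le_sup_left) (inf_le_right.trans le_sup_right)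
        · refine le_trans (le_himp_iff.2 ?_) le_sup_left
          have h1 : ((a ⊔ w) ⇨ (b ⊔ w)) ⊓ a ≤ a ⊓ (b ⊔ w) :=
            le_inf inf_le_right ((inf_le_inf_left _ le_sup_left).trans himp_inf_le)
          refine h1.trans ?_
          rw [inf_sup_left]
          exact sup_le inf_le_right hab
      rw [this]
      exact .himp _ _ iha ihb
    · have hle : a ⇨ b ≤ w := by
        -- Since `w ≤ b ⊔ ¬b`, having `u ≤ z` would give `a ⊓ w ≤ b`. Moreover `a ⇨ b ≤ ¬u`, and
        -- `¬u` either is `z` or is neither `z` nor dense, so it lies below `w`.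
        set u := a ⊓ (b ⇨ z)
        have hu : ¬ u ≤ z := fun hu => hab (by
          have h1 : a ⊓ w ≤ (a ⊓ b) ⊔ u := by
            rw [← inf_sup_left]
            exact inf_le_inf_left a (hb.decided_le hG)
          exact h1.trans (sup_le inf_le_right (hu.trans (hGen hb))))
        have h1 : a ⇨ b ≤ u ⇨ z := by
          rw [le_himp_iff, ← inf_assoc]
          exact (inf_le_inf_right _ himp_inf_le).trans inf_himp_le
        by_cases h2 : u ⇨ z = z
        · exact h1.trans (h2.le.trans hzw)
        · refine h1.trans (RelRegularity.le_of_dense hwc hV hzw hwz le_himp ?_ ?_)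
          · exact fun h => h2 (le_antisymm (himp_eq_top_iff.1 h) le_himp)
          · intro h
            apply hu
            have : u ≤ (u ⇨ z) ⇨ z := le_himp_himp
            rwa [h] at this
      rwa [sup_eq_right.2 hle]

/-- A generator that is not relatively dense lies below `w`. If all are dense, each `g ⊔ (g ⇨ z)` is
just `g`. -/
theorem exists_le_decided_or (hG : ∀ g ∈ G, z < g) :
    (∃ g ∈ G, g ≤ decided z G) ∨ decided z G = G.inf id := by
  by_cases h : ∃ g ∈ G, g ≤ decided z G
  · exact .inl h
  · refine .inr (Finset.inf_congr rfl fun g hg => ?_)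
    have : g ⇨ z = z := by
      by_contra h2
      refine h ⟨g, hg, RelRegularity.le_of_dense hwc hV (le_decided fun g hg => (hG g hg).le)
        decided_himp (hG g hg).le (fun h1 => ?_) h2⟩
      exact (hG g hg).not_ge (himp_eq_top_iff.1 h1)
    rw [this, id, sup_eq_left]
    exact (hG g hg).le

end WellConnected

/-- A generator below `w` collapses to `w` and is erased; this drives the induction on the number of
generators. -/
theorem card_erase_image_lt [DecidableEq A] {G : Finset A} {w : A} (h : ∃ g ∈ G, g ≤ w) :
    ((G.image (· ⊔ w)).erase w).card < G.card := by
  obtain ⟨g, hg, hgw⟩ := h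
  refine lt_of_lt_of_le (Finset.card_erase_lt_of_mem ?_) Finset.card_image_le
  exact Finset.mem_image.2 ⟨g, hg, sup_eq_right.2 hgw⟩

end Gen

/-! ### A uniform bound for well-connected algebras -/

/-- In well-connected algebras with relative regularity above `z`, the size of the part
generated by `z` and `n` further elements is bounded in terms of `n`. -/
theorem exists_bound_wellConnected (n : ℕ) : ∃ N : ℕ, ∀ (A : Type u) [HeytingAlgebra A],
    (∀ x y : A, x ⊔ y = ⊤ → x = ⊤ ∨ y = ⊤) →
    ∀ z : A, (∀ y b : A, z ≤ y → y ≤ b → RelRegularity y b) →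
    ∀ G : Finset A, (∀ g ∈ G, z < g) → G.card ≤ n →
      {a | Gen (insert z (G : Set A)) a}.encard ≤ N := by
  classical
  induction n with
  | zero =>
    refine ⟨2, fun A _ _ z _ G _ hcard => ?_⟩
    obtain rfl : G = ∅ := Finset.card_eq_zero.1 (Nat.le_zero.1 hcard)
    have h : {a | Gen (insert z ((∅ : Finset A) : Set A)) a} ⊆ (({z, ⊤} : Finset A) : Set A) := by
      intro a ha
      simp only [Finset.coe_insert, Finset.coe_singleton]
      induction ha with
      | base a ha => left; simpa using ha
      | inf a b _ _ iha ihb => rcases iha with rfl | rfl <;> rcases ihb with rfl | rfl <;> simp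
      | sup a b _ _ iha ihb => rcases iha with rfl | rfl <;> rcases ihb with rfl | rfl <;> simp
      | himp a b _ _ iha ihb => rcases iha with rfl | rfl <;> rcases ihb with rfl | rfl <;> simp
    refine (Set.encard_le_encard h).trans ?_
    rw [Set.encard_coe_eq_coe_finsetCard]
    exact_mod_cast Finset.card_le_two
  | succ n ih =>
    obtain ⟨N, hN⟩ := ih
    set k := 2 ^ 2 ^ (n + 1) with hk
    -- One factor `k`, bounding the traces, for each of at most two passages to a decided region.
    refine ⟨k * (k * N), fun A _ hwc z hV G hG hcard => ?_⟩
    have step : ∀ z : A, (∀ y b : A, z ≤ y → y ≤ b → RelRegularity y b) → ∀ G : Finset A,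
        (∀ g ∈ G, z < g) → G.card ≤ n + 1 → ∀ B : ℕ∞,
        {a | Gen (insert (decided z G)
          (((G.image (· ⊔ decided z G)).erase (decided z G) : Finset A) : Set A)) a}.encard ≤ B →
        {a | Gen (insert z (G : Set A)) a}.encard ≤ k * B := by
      intro z hV G hG hcard B hB
      refine (Gen.encard_le (fun g hg => (hG g hg).le) fun a ha =>
        Gen.sup_decided hwc (fun b => hV z b le_rfl) (fun g hg => (hG g hg).le) ha).trans ?_
      refine mul_le_mul' ?_ hB
      exact_mod_cast Nat.pow_le_pow_right two_pos (Nat.pow_le_pow_right two_pos hcard)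
    have drop : ∀ z : A, (∀ y b : A, z ≤ y → y ≤ b → RelRegularity y b) → ∀ G : Finset A,
        (∀ g ∈ G, z < g) → G.card ≤ n + 1 → (∃ g ∈ G, g ≤ decided z G) →
        {a | Gen (insert z (G : Set A)) a}.encard ≤ k * N := by
      intro z hV G hG hcard hex
      refine step z hV G hG hcard N (hN A hwc _ (fun y b hy => hV y b ?_) _ ?_ ?_)
      · exact (le_decided fun g hg => (hG g hg).le).trans hy
      · intro g hg
        rw [Finset.mem_erase, Finset.mem_image] at hg
        obtain ⟨hne, x, -, rfl⟩ := hg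
        exact lt_of_le_of_ne le_sup_right hne.symm
      · exact Nat.le_of_lt_succ ((card_erase_image_lt hex).trans_le hcard)
    have hk1 : (1 : ℕ∞) ≤ k := by exact_mod_cast Nat.one_le_two_pow
    push_cast
    by_cases hex : ∃ g ∈ G, g ≤ decided z G
    · exact (drop z hV G hG hcard hex).trans (le_mul_of_one_le_left' hk1)
    · have hinf := (exists_le_decided_or hwc (fun b => hV z b le_rfl) hG).resolve_left hex
      set w := decided z G with hw
      have hwG : ∀ g ∈ G, w < g := fun g hg =>
        lt_of_le_not_ge (hinf ▸ Finset.inf_le (f := id) hg) fun h => hex ⟨g, hg, h⟩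
      have hVw : ∀ y b : A, w ≤ y → y ≤ b → RelRegularity y b := fun y b hy =>
        hV y b ((le_decided fun g hg => (hG g hg).le).trans hy)
      refine step z hV G hG hcard _ ?_
      have himg : (G.image (· ⊔ w)).erase w = G := by
        have h1 : G.image (· ⊔ w) = G := by
          conv_rhs => rw [← Finset.image_id (s := G)]
          exact Finset.image_congr fun g hg => sup_eq_left.2 (hwG g hg).le
        rw [h1, Finset.erase_eq_of_notMem fun h => lt_irrefl _ (hwG w h)]
      rw [← hw, himg]
      -- If the second passage also keeps every generator, then `decided w G` is again the meet of
      -- `G`, that is `w`. As it is dense relative to `w`, this forces `w = ⊤`, so no generator lies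
      -- above it.
      by_cases hex' : ∃ g ∈ G, g ≤ decided w G
      · exact drop w hVw G hwG hcard hex'
      · have hinf' := (exists_le_decided_or hwc (fun b => hVw w b le_rfl) hwG).resolve_left hex'
        have hww : w ⇨ w = w := by
          conv_lhs => arg 1; rw [hinf, ← hinf']
          exact decided_himp
        rw [himp_self] at hww
        obtain rfl : G = ∅ := Finset.eq_empty_of_forall_notMem fun g hg =>
          not_top_lt (hww ▸ hwG g hg)
        exact (hN A hwc w hVw ∅ hwG (Nat.zero_le n)).trans (le_mul_of_one_le_left' hk1)

/-! ### From well-connected quotients to arbitrary algebras -/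

/-- A generated set is finite if a family of maps with values in a fixed finite type separates
its points and is compatible with the operations. -/
theorem Gen.finite_of_separating {A : Type u} [HeytingAlgebra A] {S : Set A} (hS : S.Finite)
    {I : Type*} {N : ℕ} (ι : I → A → Fin N)
    (hinf : ∀ i a a' b b', Gen S a → Gen S a' → Gen S b → Gen S b' → ι i a = ι i a' →
      ι i b = ι i b' → ι i (a ⊓ b) = ι i (a' ⊓ b'))
    (hsup : ∀ i a a' b b', Gen S a → Gen S a' → Gen S b → Gen S b' → ι i a = ι i a' →
      ι i b = ι i b' → ι i (a ⊔ b) = ι i (a' ⊔ b'))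
    (himp : ∀ i a a' b b', Gen S a → Gen S a' → Gen S b → Gen S b' → ι i a = ι i a' →
      ι i b = ι i b' → ι i (a ⇨ b) = ι i (a' ⇨ b'))
    (hsep : ∀ a b, Gen S a → Gen S b → (∀ i, ι i a = ι i b) → a = b) :
    {a | Gen S a}.Finite := by
  have := hS.to_subtype
  let table (op : A → A → A) (i : I) : Set (Fin N × Fin N × Fin N) :=
    {t | ∃ a b, Gen S a ∧ Gen S b ∧ ι i a = t.1 ∧ ι i b = t.2.1 ∧ ι i (op a b) = t.2.2}
  -- There are finitely many combinations of operation tables and generator values, and each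
  -- determines `ι i` on all generated elements. One index per kind therefore separates points.
  let kind (i : I) : Set (Fin N × Fin N × Fin N) × Set (Fin N × Fin N × Fin N) ×
      Set (Fin N × Fin N × Fin N) × (S → Fin N) :=
    (table (· ⊓ ·) i, table (· ⊔ ·) i, table (· ⇨ ·) i, fun s => ι i s)
  have key : ∀ i j, kind i = kind j → ∀ a, Gen S a → ι i a = ι j a := by
    intro i j hij a ha
    simp only [kind, Prod.mk.injEq] at hij
    obtain ⟨h1, h2, h3, h4⟩ := hij
    have aux : ∀ op : A → A → A,
        (∀ i a a' b b', Gen S a → Gen S a' → Gen S b → Gen S b' → ι i a = ι i a' →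
          ι i b = ι i b' → ι i (op a b) = ι i (op a' b')) →
        table op i = table op j → ∀ a b, Gen S a → Gen S b → ι i a = ι j a → ι i b = ι j b →
        ι i (op a b) = ι j (op a b) := by
      intro op hop ht a b ha hb hia hib
      have hmem : (ι i a, ι i b, ι i (op a b)) ∈ table op i := ⟨a, b, ha, hb, rfl, rfl, rfl⟩
      rw [ht] at hmem
      obtain ⟨a', b', ha', hb', h1, h2, h3⟩ := hmem
      exact h3.symm.trans (hop j a' a b' b ha' ha hb' hb (h1.trans hia) (h2.trans hib))
    induction ha with
    | base a ha => exact congrFun h4 ⟨a, ha⟩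
    | inf a b ha hb iha ihb => exact aux _ hinf h1 a b ha hb iha ihb
    | sup a b ha hb iha ihb => exact aux _ hsup h2 a b ha hb iha ihb
    | himp a b ha hb iha ihb => exact aux _ himp h3 a b ha hb iha ihb
  have hchoose : ∀ κ : Set.range kind, ∃ i, kind i = κ := fun κ => κ.2
  choose rep hrep using hchoose
  refine Set.Finite.of_finite_image (f := fun a (κ : Set.range kind) => ι (rep κ) a)
    (Set.toFinite _) fun a ha b hb hab => hsep a b ha hb fun i => ?_
  have h := congrFun hab ⟨kind i, i, rfl⟩
  have hk := hrep ⟨kind i, i, rfl⟩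
  rw [← key _ _ hk a ha, ← key _ _ hk b hb]
  exact h

section WellConnectedQuotients

open Order

/-- Inequivalent elements are separated by a well-connected quotient. -/
theorem exists_wellConnected_quotient {A : Type u} [HeytingAlgebra A] {a b : A} (hab : ¬ a ≤ b) :
    ∃ F : PFilter A, (∀ x y : A, x ⊔ y ∈ F → x ∈ F ∨ y ∈ F) ∧ a ⇨ b ∉ F := by
  have hd : Disjoint (PFilter.principal a : Set A) (Ideal.principal b : Set A) := by
    rw [Set.disjoint_left]
    intro x hx hx'
    exact hab (le_trans (PFilter.mem_principal.1 hx) (Ideal.mem_principal.1 hx'))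
  obtain ⟨J, hJ, hbJ, haJ⟩ := DistribLattice.prime_ideal_of_disjoint_filter_ideal hd
  have hF : ∀ x, x ∈ hJ.toPrimePair.F ↔ x ∉ J := fun x => by
    have := hJ.toPrimePair.compl_I_eq_F
    rw [← SetLike.mem_coe, ← this]; rfl
  refine ⟨hJ.toPrimePair.F, fun x y hxy => ?_, fun h => ?_⟩
  · rw [hF] at hxy
    rw [hF, hF, ← not_and_or]
    exact fun h => hxy (Ideal.sup_mem h.1 h.2)
  · have ha : a ∈ hJ.toPrimePair.F :=
      (hF a).2 (Set.disjoint_left.1 haJ (PFilter.mem_principal.2 le_rfl))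
    have hb := PFilter.mem_of_le himp_inf_le (PFilter.inf_mem h ha)
    exact (hF b).1 hb (hbJ (Ideal.mem_principal.2 le_rfl))

theorem Gen.image {A B : Type*} [HeytingAlgebra A] [HeytingAlgebra B] (f : A → B)
    (hinf : ∀ a b, f (a ⊓ b) = f a ⊓ f b) (hsup : ∀ a b, f (a ⊔ b) = f a ⊔ f b)
    (himp : ∀ a b, f (a ⇨ b) = f a ⇨ f b) {S : Set A} {a : A} (ha : Gen S a) :
    Gen (f '' S) (f a) := by
  induction ha with
  | base a ha => exact .base _ (Set.mem_image_of_mem f ha)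
  | inf a b _ _ iha ihb => rw [hinf]; exact .inf _ _ iha ihb
  | sup a b _ _ iha ihb => rw [hsup]; exact .sup _ _ iha ihb
  | himp a b _ _ iha ihb => rw [himp]; exact .himp _ _ iha ihb

theorem RelRegularity.filterMk {A : Type u} [HeytingAlgebra A] (F : PFilter A) {z b : A}
    (h : RelRegularity z b) : RelRegularity (filterMk F z) (filterMk F b) := by
  unfold RelRegularity at h ⊢
  simp only [← filterMk_himp, ← filterMk_sup, h, filterMk_top]

/-- Finitely generated parts above a point with relative regularity are finite. -/
theorem Gen.finite_of_relRegularity {A : Type u} [HeytingAlgebra A] {z : A}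
    (hV : ∀ y b : A, z ≤ y → y ≤ b → RelRegularity y b) {S : Set A} (hS : S.Finite)
    (hzS : ∀ s ∈ S, z ≤ s) : {a | Gen S a}.Finite := by
  classical
  obtain ⟨N, hN⟩ := exists_bound_wellConnected.{u} (hS.toFinset.card)
  have hbound : ∀ F : PFilter A, (∀ x y : A, x ⊔ y ∈ F → x ∈ F ∨ y ∈ F) →
      (filterMk F '' {a | Gen S a}).encard ≤ N := by
    intro F hF
    set G := (hS.toFinset.image (filterMk F)).erase (filterMk F z) with hG
    have hmono : ∀ {x y : A}, x ≤ y → filterMk F x ≤ filterMk F y := fun hxy => by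
      rw [filterMk_le, himp_eq_top_iff.2 hxy]; exact PFilter.top_mem
    refine le_trans (Set.encard_le_encard ?_) (hN _ ?_ (filterMk F z) ?_ G ?_ ?_)
    · rintro _ ⟨a, ha, rfl⟩
      refine (Gen.image (filterMk F) (fun _ _ => rfl) (fun _ _ => rfl) (fun _ _ => rfl)
        ha).of_subset ?_
      rintro _ ⟨s, hs, rfl⟩
      refine .base _ ?_
      by_cases h : filterMk F s = filterMk F z
      · exact .inl h
      · exact .inr (Finset.mem_coe.2 (Finset.mem_erase.2
          ⟨h, Finset.mem_image_of_mem _ (hS.mem_toFinset.2 hs)⟩))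
    · intro x y hxy
      obtain ⟨x, rfl⟩ := filterMk_surjective F x
      obtain ⟨y, rfl⟩ := filterMk_surjective F y
      rw [← filterMk_sup, filterMk_eq_top] at hxy
      rw [filterMk_eq_top, filterMk_eq_top]
      exact hF x y hxy
    · intro y b hy hb
      obtain ⟨y, rfl⟩ := filterMk_surjective F y
      obtain ⟨b, rfl⟩ := filterMk_surjective F b
      -- The lifts need not satisfy `z ≤ y ≤ b`; joining corrects them without changing their
      -- classes.
      have h1 : filterMk F (y ⊔ z) = filterMk F y := by rw [filterMk_sup, sup_eq_left.2 hy]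
      have h2 : filterMk F (b ⊔ (y ⊔ z)) = filterMk F b := by
        rw [filterMk_sup, h1, sup_eq_left.2 hb]
      rw [← h1, ← h2]
      exact (hV _ _ le_sup_right le_sup_right).filterMk F
    · intro g hg
      rw [hG, Finset.mem_erase, Finset.mem_image] at hg
      obtain ⟨hne, s, hs, rfl⟩ := hg
      exact lt_of_le_of_ne (hmono (hzS s (hS.mem_toFinset.1 hs))) hne.symm
    · exact (Finset.card_erase_le).trans Finset.card_image_le
  let I := {F : PFilter A // ∀ x y : A, x ⊔ y ∈ F → x ∈ F ∨ y ∈ F}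
  -- `N + 1` keeps the target nonempty even when `N = 0`.
  have hι : ∀ i : I, ∃ ι : A → Fin (N + 1), ∀ a b, Gen S a → Gen S b →
      (ι a = ι b ↔ filterMk i.1 a = filterMk i.1 b) := by
    rintro ⟨F, hF⟩
    have hfin := (Set.encard_le_coe_iff_finite_ncard_le.1 (hbound F hF)).1
    obtain ⟨e, he⟩ : ∃ e : (filterPreHeyting F).Quo → Fin (N + 1),
        Set.InjOn e (filterMk F '' {a | Gen S a}) := by
      obtain ⟨e, -, he⟩ := hfin.exists_injOn_of_encard_le (t := (Set.univ : Set (Fin (N + 1)))) (by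
        rw [Set.encard_univ, ENat.card_eq_coe_fintype_card, Fintype.card_fin]
        exact (hbound F hF).trans (by exact_mod_cast Nat.le_succ N))
      exact ⟨e, he⟩
    exact ⟨fun a => e (filterMk F a), fun a b ha hb =>
      ⟨fun h => he ⟨a, ha, rfl⟩ ⟨b, hb, rfl⟩ h, fun h => congrArg e h⟩⟩
  choose ι hι using hι
  refine Gen.finite_of_separating hS ι ?_ ?_ ?_ ?_
  · intro i a a' b b' ha ha' hb hb' h1 h2
    rw [hι i _ _ ha ha'] at h1
    rw [hι i _ _ hb hb'] at h2
    rw [hι i _ _ (.inf _ _ ha hb) (.inf _ _ ha' hb'), filterMk_inf, filterMk_inf, h1, h2]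
  · intro i a a' b b' ha ha' hb hb' h1 h2
    rw [hι i _ _ ha ha'] at h1
    rw [hι i _ _ hb hb'] at h2
    rw [hι i _ _ (.sup _ _ ha hb) (.sup _ _ ha' hb'), filterMk_sup, filterMk_sup, h1, h2]
  · intro i a a' b b' ha ha' hb hb' h1 h2
    rw [hι i _ _ ha ha'] at h1
    rw [hι i _ _ hb hb'] at h2
    rw [hι i _ _ (.himp _ _ ha hb) (.himp _ _ ha' hb'), filterMk_himp, filterMk_himp, h1, h2]
  · intro a b ha hb hab
    have : ∀ a b, Gen S a → Gen S b → (∀ i, ι i a = ι i b) → a ≤ b := by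
      intro a b ha hb hab
      by_contra hle
      obtain ⟨F, hF, hnot⟩ := exists_wellConnected_quotient hle
      have h := (hι ⟨F, hF⟩ a b ha hb).1 (hab ⟨F, hF⟩)
      exact hnot ((filterMk_le F).1 h.le)
    exact le_antisymm (this a b ha hb hab) (this b a hb ha fun i => (hab i).symm)

/-- If relative regularity holds over all dense elements, finitely generated subalgebras are
finite. -/
theorem Gen.finite_of_relRegularity_dense {A : Type u} [HeytingAlgebra A]
    (hV : ∀ z b : A, z ⇨ ⊥ = ⊥ → z ≤ b → RelRegularity z b) (G : Finset A) :
    {a | Gen (insert ⊥ (G : Set A)) a}.Finite := by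
  classical
  have hG : ∀ g ∈ G, ⊥ ≤ g := fun _ _ => bot_le
  obtain ⟨M, -, hM⟩ := exists_traces hG
  set w := decided ⊥ G with hw
  -- Without well-connectedness, `(a ⇨ b) ⊔ w` depends also on the implication between the traces of
  -- `a` and `b`. The traces lie in the finite set `M`, so the third family of generators accounts
  -- for it.
  set T : Finset A := insert w (G.image (· ⊔ w) ∪ Finset.image₂ (fun m m' => (m ⇨ m') ⊔ w) M M)
    with hT
  have hdense : w ⇨ ⊥ = ⊥ := decided_himp
  have hTfin : {a | Gen (T : Set A) a}.Finite := by
    refine Gen.finite_of_relRegularity (z := w) (fun y b hy hb => hV y b ?_ hb) T.finite_toSet ?_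
    · exact le_bot_iff.1 ((himp_le_himp_right hy).trans hdense.le)
    · intro s hs
      rw [Finset.mem_coe, hT, Finset.mem_insert, Finset.mem_union, Finset.mem_image,
        Finset.mem_image₂] at hs
      rcases hs with rfl | ⟨g, -, rfl⟩ | ⟨m, -, m', -, rfl⟩
      exacts [le_rfl, le_sup_right, le_sup_right]
  have hmain : ∀ a, Gen (insert ⊥ (G : Set A)) a → Gen (T : Set A) (a ⊔ w) := by
    intro a ha
    induction ha with
    | base a ha =>
      refine .base _ ?_
      rw [Finset.mem_coe, hT, Finset.mem_insert, Finset.mem_union]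
      rcases ha with rfl | ha
      · exact .inl (bot_sup_eq _)
      · exact .inr (.inl (Finset.mem_image_of_mem _ ha))
    | inf a b _ _ iha ihb => rw [sup_inf_right]; exact .inf _ _ iha ihb
    | sup a b _ _ iha ihb => rw [sup_sup_distrib_right]; exact .sup _ _ iha ihb
    | himp a b ha hb iha ihb =>
      have heq : (a ⇨ b) ⊔ w =
          ((a ⊔ w) ⇨ (b ⊔ w)) ⊓ (((a ⊓ w) ⇨ (b ⊓ w)) ⊔ w) := by
        apply le_antisymm
        · refine le_inf (sup_le (le_himp_iff.2 ?_) (le_sup_right.trans le_himp))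
            (sup_le_sup_right (le_himp_iff.2 ?_) w)
          · rw [inf_sup_left]
            exact sup_le (himp_inf_le.trans le_sup_left) (inf_le_right.trans le_sup_right)
          · rw [← inf_assoc]
            exact inf_le_inf_right w himp_inf_le
        · rw [inf_sup_left]
          refine sup_le (le_trans (le_himp_iff.2 ?_) le_sup_left) (inf_le_right.trans le_sup_right)
          set p := (a ⊔ w) ⇨ (b ⊔ w)
          set q := (a ⊓ w) ⇨ (b ⊓ w)
          have h1 : p ⊓ q ⊓ a ≤ (q ⊓ a) ⊓ (b ⊔ w) := by
            refine le_inf (inf_le_inf_right a inf_le_right) ?_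
            exact (inf_le_inf inf_le_left le_sup_left).trans himp_inf_le
          refine h1.trans ?_
          rw [inf_sup_left]
          refine sup_le inf_le_right ?_
          rw [inf_assoc]
          exact himp_inf_le.trans inf_le_left
      rw [heq]
      refine .inf _ _ (.himp _ _ iha ihb) (.base _ ?_)
      rw [Finset.mem_coe, hT, Finset.mem_insert, Finset.mem_union]
      exact .inr (.inr (Finset.mem_image₂_of_mem (hM a ha) (hM b hb)))
  rw [← Set.encard_lt_top_iff]
  refine (Gen.encard_le hG hmain).trans_lt ?_
  exact WithTop.mul_lt_top (ENat.natCast_lt_top _) (Set.encard_lt_top_iff.2 hTfin)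

end WellConnectedQuotients

/-! ### Varieties omitting `P2` -/

/-- A copy of `P2` in an arbitrary universe. -/
instance P2.uliftHeyting : HeytingAlgebra (ULift.{u} P2) where
  le x y := x.down ≤ y.down
  le_refl x := le_refl x.down
  le_trans _ _ _ h k := le_trans (α := P2) h k
  le_antisymm _ _ h k := ULift.ext _ _ (le_antisymm (α := P2) h k)
  inf x y := ⟨x.down ⊓ y.down⟩
  sup x y := ⟨x.down ⊔ y.down⟩
  himp x y := ⟨x.down ⇨ y.down⟩
  compl x := ⟨x.downᶜ⟩
  top := ⟨⊤⟩
  bot := ⟨⊥⟩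
  inf_le_left x y := inf_le_left (α := P2)
  inf_le_right x y := inf_le_right (α := P2)
  le_inf _ _ _ h k := le_inf (α := P2) h k
  le_sup_left x y := le_sup_left (α := P2)
  le_sup_right x y := le_sup_right (α := P2)
  sup_le _ _ _ h k := sup_le (α := P2) h k
  le_top _ := le_top (α := P2)
  bot_le _ := bot_le (α := P2)
  le_himp_iff _ _ _ := le_himp_iff (α := P2)
  himp_bot x := ULift.ext _ _ (himp_bot x.down)

theorem isLocallyFiniteClass_of_omits_P2
    (K : ∀ (A : Type u) [HeytingAlgebra A], Prop) (hK : IsHeytingVariety K)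
    (hP : OmitsAlgebra K P2) : IsLocallyFiniteClass K := by
  intro A _ hA ⟨G, hGfin, hG⟩
  obtain ⟨E, hE⟩ := hK
  have hV : ∀ z b : A, z ⇨ ⊥ = ⊥ → z ≤ b → RelRegularity z b := by
    intro z b hz hzb
    by_contra hr
    have hmem : K (ULift.{u} P2) := by
      rw [hE]
      intro e he v
      have hval := P2.valid_of_not_relRegularity hz hzb hr ((hE A).1 hA e he)
        (ULift.down ∘ v)
      have hdown : ∀ p : PropFormula, (p.eval v).down = p.eval (ULift.down ∘ v) :=
        PropFormula.map_eval ULift.down rfl (fun _ _ => rfl) (fun _ _ => rfl) (fun _ _ => rfl) v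
      exact ULift.ext _ _ (by rw [hdown, hdown, hval])
    exact (hP _ hmem).false ⟨Equiv.ulift, Iff.rfl⟩
  have hfin := Gen.finite_of_relRegularity_dense hV hGfin.toFinset
  rw [Set.Finite.coe_toFinset] at hfin
  have hbot : Gen (insert ⊥ G) (⊥ : A) := .base _ (Set.mem_insert _ _)
  have huniv := hG {a | Gen (insert ⊥ G) a}
    { bot_mem := hbot
      top_mem := by
        have : Gen (insert ⊥ G) ((⊥ : A) ⇨ ⊥) := .himp _ _ hbot hbot
        rwa [himp_self] at this
      inf_mem := fun a ha b hb => .inf a b ha hb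
      sup_mem := fun a ha b hb => .sup a b ha hb
      himp_mem := fun a ha b hb => .himp a b ha hb
      compl_mem := fun a ha => by
        have : Gen (insert ⊥ G) (a ⇨ ⊥) := .himp _ _ ha hbot
        rwa [himp_bot] at this }
    fun g hg => .base _ (.inr hg)
  rw [huniv] at hfin
  exact Set.finite_univ_iff.1 hfin

/-! ### Superintuitionistic logics through the Lindenbaum algebra -/

namespace IsSILogic

open PropFormula

variable {L : Set PropFormula} (hL : IsSILogic L)
include hL

theorem mp {p q : PropFormula} (h : imp p q ∈ L) (k : p ∈ L) : q ∈ L :=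
  hL.modus_ponens p q h k

theorem weaken {p : PropFormula} (h : p ∈ L) (q : PropFormula) : imp q p ∈ L :=
  hL.mp (hL.int_subset _ (.k p q)) h

theorem mp_under {p q r : PropFormula} (h : imp p (imp q r) ∈ L) (k : imp p q ∈ L) :
    imp p r ∈ L :=
  hL.mp (hL.mp (hL.int_subset _ (.s p q r)) k) h

theorem imp_trans {p q r : PropFormula} (h : imp p q ∈ L) (k : imp q r ∈ L) : imp p r ∈ L :=
  hL.mp_under (hL.weaken k p) h

theorem imp_self (p : PropFormula) : imp p p ∈ L :=
  hL.mp_under (hL.int_subset _ (.k p (imp p p))) (hL.int_subset _ (.k p p))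

theorem imp_and {p q r : PropFormula} (h : imp p q ∈ L) (k : imp p r ∈ L) :
    imp p (and q r) ∈ L :=
  hL.mp_under (hL.imp_trans h (hL.int_subset _ (.and_intro q r))) k

theorem or_imp {p q r : PropFormula} (h : imp p r ∈ L) (k : imp q r ∈ L) :
    imp (or p q) r ∈ L :=
  hL.mp (hL.mp (hL.int_subset _ (.or_elim p q r)) h) k

theorem and_left (p q : PropFormula) : imp (and p q) p ∈ L := hL.int_subset _ (.and_left p q)

theorem and_right (p q : PropFormula) : imp (and p q) q ∈ L := hL.int_subset _ (.and_right p q)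

theorem uncurry {p q r : PropFormula} (h : imp p (imp q r) ∈ L) : imp (and p q) r ∈ L :=
  hL.mp_under (hL.imp_trans (hL.and_left p q) h) (hL.and_right p q)

theorem curry {p q r : PropFormula} (h : imp (and p q) r ∈ L) : imp p (imp q r) ∈ L := by
  have h1 : imp p (imp q (imp (and p q) r)) ∈ L := hL.weaken (hL.weaken h q) p
  have h2 := hL.int_subset _ (.and_intro p q)
  have h3 := hL.weaken (hL.int_subset _ (.s q (and p q) r)) p
  exact hL.mp_under (hL.mp_under h3 h2) h1

theorem contradiction_imp (p q : PropFormula) : imp (and p (neg p)) q ∈ L :=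
  hL.mp_under (hL.imp_trans (hL.and_right p (neg p)) (hL.int_subset _ (.neg_elim p q)))
    (hL.and_left p (neg p))

/-- Formulas ordered by provable implication. -/
def preHeyting : PreHeyting PropFormula where
  le p q := imp p q ∈ L
  inf := and
  sup := or
  himp := imp
  bot := and (var 0) (neg (var 0))
  le_refl := hL.imp_self
  le_trans _ _ _ := hL.imp_trans
  inf_le_left := hL.and_left
  inf_le_right := hL.and_right
  le_inf _ _ _ := hL.imp_and
  le_sup_left p q := hL.int_subset _ (.or_left p q)
  le_sup_right p q := hL.int_subset _ (.or_right p q)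
  sup_le _ _ _ := hL.or_imp
  le_himp_iff _ _ _ := ⟨hL.uncurry, hL.curry⟩
  bot_le := hL.contradiction_imp (var 0)

/-- The formulas have primitive negation and no falsum, so negation must be matched with implication
into the contradiction that serves as bottom. -/
theorem cls_neg (p : PropFormula) :
    hL.preHeyting.cls (neg p) = (hL.preHeyting.cls p)ᶜ := by
  rw [← himp_bot]
  apply le_antisymm
  · exact hL.int_subset _ (.neg_elim p _)
  · have h3 : ∀ r : PropFormula, imp (imp p hL.preHeyting.bot) (imp p r) ∈ L := fun r =>
      hL.curry (hL.imp_trans (hL.uncurry (hL.imp_self _)) (hL.contradiction_imp (var 0) r))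
    have h4 := hL.weaken (hL.int_subset _ (.neg_intro p p)) (imp p hL.preHeyting.bot)
    exact hL.mp_under (hL.mp_under h4 (h3 p)) (h3 (neg p))

theorem eval_cls (s : ℕ → PropFormula) (p : PropFormula) :
    p.eval (fun i => hL.preHeyting.cls (s i)) = hL.preHeyting.cls (p.subst s) := by
  induction p with
  | var i => rfl
  | and p q hp hq => rw [eval, hp, hq]; rfl
  | or p q hp hq => rw [eval, hp, hq]; rfl
  | imp p q hp hq => rw [eval, hp, hq]; rfl
  | neg p hp => rw [eval, hp, ← hL.cls_neg]; rfl

theorem cls_eq_top {p : PropFormula} (h : p ∈ L) : hL.preHeyting.cls p = ⊤ :=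
  top_le_iff.1 (hL.weaken h _)

/-- A valuation in the Lindenbaum algebra is a substitution up to equivalence, and `L` is closed
under substitution. -/
theorem isModelOf_lindenbaum : IsModelOf hL.preHeyting.Quo L := by
  intro p hp v
  choose s hs using fun i => hL.preHeyting.cls_surjective (v i)
  obtain rfl : (fun i => hL.preHeyting.cls (s i)) = v := funext hs
  rw [hL.eval_cls]
  exact hL.cls_eq_top (hL.substitution s p hp)

theorem gen_cls {X : Set ℕ} {p : PropFormula} (hp : p.vars ⊆ X) :
    Gen (insert ⊥ ((fun i => hL.preHeyting.cls (var i)) '' X)) (hL.preHeyting.cls p) := by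
  induction p with
  | var i => exact .base _ (.inr ⟨i, hp rfl, rfl⟩)
  | and p q ihp ihq =>
    exact .inf _ _ (ihp (Set.subset_union_left.trans hp)) (ihq (Set.subset_union_right.trans hp))
  | or p q ihp ihq =>
    exact .sup _ _ (ihp (Set.subset_union_left.trans hp)) (ihq (Set.subset_union_right.trans hp))
  | imp p q ihp ihq =>
    exact .himp _ _ (ihp (Set.subset_union_left.trans hp)) (ihq (Set.subset_union_right.trans hp))
  | neg p ihp =>
    rw [hL.cls_neg, ← himp_bot]
    exact .himp _ _ (ihp hp) (.base _ (Set.mem_insert _ _))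

theorem isLocallyTabular_of_not_isModelOf_P2 (hP : ¬ IsModelOf P2 L) : IsLocallyTabular L := by
  classical
  intro X hX
  have hV : ∀ z b : hL.preHeyting.Quo, z ⇨ ⊥ = ⊥ → z ≤ b → RelRegularity z b := by
    intro z b hz hzb
    by_contra hr
    refine hP fun p hp v => ?_
    -- Validity of `p` is the identity `p ≈ p → p`, whose right side always has value `⊤`.
    have h := P2.valid_of_not_relRegularity hz hzb hr (s := p) (t := imp p p)
      (fun w => by rw [hL.isModelOf_lindenbaum p hp w, eval, himp_self]) v
    rw [h, eval, himp_self]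
  have hfin := Gen.finite_of_relRegularity_dense hV
    (hX.toFinset.image fun i => hL.preHeyting.cls (var i))
  rw [Finset.coe_image, Set.Finite.coe_toFinset] at hfin
  choose rep hrep using hL.preHeyting.cls_surjective
  refine ⟨rep '' _, hfin.image rep, fun p hp => ⟨_, ⟨_, hL.gen_cls hp, rfl⟩, ?_, ?_⟩⟩
  · exact hL.preHeyting.cls_le_cls.1 (hrep (hL.preHeyting.cls p)).ge
  · exact hL.preHeyting.cls_le_cls.1 (hrep (hL.preHeyting.cls p)).le

end IsSILogic

theorem mainTheorem2 :
    (∀ K : (∀ (A : Type u) [HeytingAlgebra A], Prop),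
      IsHeytingVariety K → OmitsAlgebra K P2 → IsLocallyFiniteClass K) ∧
    (∀ L : Set PropFormula,
      IsSILogic L → ¬ IsModelOf P2 L → IsLocallyTabular L) :=
  ⟨isLocallyFiniteClass_of_omits_P2, fun _ hL hP => hL.isLocallyTabular_of_not_isModelOf_P2 hP⟩
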